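/- Let $n\ge 1$. For a random vector $Z$ in $\mathbb R^n$ with density $g$ with respect to Lebesgue measure, $Z$ has finite entropy if $g\log g$ is Lebesgue integrable; then let $$h(Z)=-\int_{\mathbb R^n} g(z)\log g(z)\,dz,\qquad \mathcal N(Z)=\exp\Big\{\frac{2h(Z)}{n}\Big\},$$ with natural logarithms and $0\log 0=0$. For random vectors $X,Y$ in $\mathbb R^n$ let $$d_R(X\|Y)=h(X'-Y')-h(X'),\qquad \sigma_-(X)=\frac{\mathcal N(X-X'')}{2\mathcal N(X)},$$ where $X'$ and $Y'$ are independent and have the distributions of $X$ and $Y$, respectively, and $X''$ is an independent copy of $X$; $d_R(X\|Y)$ is well-defined and finite if $X$, $Y$ and $X'-Y'$ have finite entropy. A random vector in $\mathbb R^n$ is log-concave if it has a density $f$ with respect to Lebesgue measure such that $f(\alpha x+(1-\alpha)y)\ge f(x)^{\alpha}f(y)^{1-\alpha}$ for all $x,y\in\mathbb R^n$ and $0\le\alpha\le 1$. Let $X$ be a log-concave random vector in $\mathbb R^n$. Then $X$ has finite entropy, $d_R(X\|X)$ and $d_R(X\|-X)$ are well-defined and finite, and the following hold. (1) If $X'$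 is independent of $X$ and has the same distribution as $X$, then $X-X'$ has finite entropy and $\mathcal N(X-X')\le 16\,\mathcal N(X)$. (2) $\sigma_-(X)\le 8$. (3) $d_R(X\|X)\le 2n\log 2$, which is equivalent to (2) through the identity $\sigma_-(X)=\frac12\exp\{\frac2n d_R(X\|X)\}$, also asserted here. (4) $d_R(X\|-X)\le n\log 2$. -/

import Mathlib

open MeasureTheory ProbabilityTheory

namespace RuzsaEntropy

/-- A real function `f ≥ 0` on `ℝⁿ` is log-concave when
`f (α x + (1 - α) y) ≥ f(x)^α f(y)^(1-α)` for all `x, y` and `0 ≤ α ≤ 1`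
(here `0 ^ 0 = 1`, so the inequality is trivial at `α = 0` and `α = 1`). -/
def LogConcaveFun {n : ℕ} (f : EuclideanSpace ℝ (Fin n) → ℝ) : Prop :=
  (∀ x, 0 ≤ f x) ∧
    ∀ x y : EuclideanSpace ℝ (Fin n), ∀ α : ℝ, 0 ≤ α → α ≤ 1 →
      f x ^ α * f y ^ (1 - α) ≤ f (α • x + (1 - α) • y)

/-- The random vector `X` has a log-concave density with respect to Lebesgue measure. -/
def LogConcaveVector {Ω : Type*} [MeasurableSpace Ω] {n : ℕ}
    (X : Ω → EuclideanSpace ℝ (Fin n)) (P : Measure Ω) : Prop :=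
  AEMeasurable X P ∧
    ∃ f : EuclideanSpace ℝ (Fin n) → ℝ, Measurable f ∧ LogConcaveFun f ∧
      P.map X = volume.withDensity (fun x => ENNReal.ofReal (f x))

/-- Differential entropy in nats, `h(X) = -∫ f log f`, where `f` is the density of `X` with
respect to Lebesgue measure. It is meaningful when `HasFiniteEntropy X P` holds. -/
noncomputable def entropy {Ω : Type*} [MeasurableSpace Ω] {n : ℕ}
    (X : Ω → EuclideanSpace ℝ (Fin n)) (P : Measure Ω) : ℝ :=
  -∫ x, (pdf X P volume x).toReal * Real.log (pdf X P volume x).toReal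

/-- `X` has a density `f`, and `f log f` is Lebesgue integrable: `h(X)` exists and is finite. -/
def HasFiniteEntropy {Ω : Type*} [MeasurableSpace Ω] {n : ℕ}
    (X : Ω → EuclideanSpace ℝ (Fin n)) (P : Measure Ω) : Prop :=
  HasPDF X P volume ∧
    Integrable (fun x => (pdf X P volume x).toReal * Real.log (pdf X P volume x).toReal) volume

/-- Entropy power `𝒩(X) = exp (2 h(X) / n)`. -/
noncomputable def entropyPower {Ω : Type*} [MeasurableSpace Ω] {n : ℕ}
    (X : Ω → EuclideanSpace ℝ (Fin n)) (P : Measure Ω) : ℝ :=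
  Real.exp (2 * entropy X P / n)

/-- The joint law of independent random vectors `X'`, `Y'` with the laws of `X`, `Y`. On the
product space with this measure the two coordinate projections are such `X'` and `Y'`. -/
noncomputable def indepCopies {Ω : Type*} [MeasurableSpace Ω] {n : ℕ}
    (X Y : Ω → EuclideanSpace ℝ (Fin n)) (P : Measure Ω) :
    Measure (EuclideanSpace ℝ (Fin n) × EuclideanSpace ℝ (Fin n)) :=
  (P.map X).prod (P.map Y)

/-- Ruzsa divergence `d_R(X‖Y) = h(X' - Y') - h(X')`, with `X'`, `Y'` independent copies of
`X`, `Y`. -/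
noncomputable def ruzsaDiv {Ω : Type*} [MeasurableSpace Ω] {n : ℕ}
    (X Y : Ω → EuclideanSpace ℝ (Fin n)) (P : Measure Ω) : ℝ :=
  entropy (fun p => p.1 - p.2) (indepCopies X Y P) - entropy (fun p => p.1) (indepCopies X Y P)

/-- `X` and `Y` have finite entropy and so does `X' - Y'`, for independent copies `X'`, `Y'`:
`d_R(X‖Y)` is well-defined and finite. -/
def HasFiniteRuzsaDiv {Ω : Type*} [MeasurableSpace Ω] {n : ℕ}
    (X Y : Ω → EuclideanSpace ℝ (Fin n)) (P : Measure Ω) : Prop :=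
  HasFiniteEntropy X P ∧ HasFiniteEntropy Y P ∧
    HasFiniteEntropy (fun p => p.1 - p.2) (indepCopies X Y P)

/-- Difference constant `σ₋(X) = 𝒩(X - X') / (2 𝒩(X))`, with `X'` an independent copy of `X`. -/
noncomputable def differenceConstant {Ω : Type*} [MeasurableSpace Ω] {n : ℕ}
    (X : Ω → EuclideanSpace ℝ (Fin n)) (P : Measure Ω) : ℝ :=
  entropyPower (fun p => p.1 - p.2) (indepCopies X X P) / (2 * entropyPower X P)

end RuzsaEntropy

open Filter Topology
open scoped ENNReal

namespace RuzsaEntropy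

/-! ### Log-concave densities: boundedness and exponential decay -/

section LogConcave

variable {n : ℕ} {f : EuclideanSpace ℝ (Fin n) → ℝ}

/-! Let `μ` be the law of `X`, with density `f`, and let `ν` and `τ` be the laws of `X + X'` and `X
- X'` for independent copies. Everything reduces to two inequalities between the entropies of `μ`,
`ν` and `τ`, each proved by exhibiting a `U` with `𝔼 e^U ≤ 1` and applying Jensen.

Doubling (`lawEntropy_add_le`): midpoint log-concavity `√(f x) √(f y) ≤ f ((x + y) / 2)` bounds the
average of `log f x` and `log f y` by `n log 2` plus the log of the density `2⁻ⁿ f (s / 2)` at `s =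
x + y`. Comparing this density with that of `ν` (Gibbs) gives `h(ν) ≤ h(μ) + n log 2`, which is (4)
because `X' - (-Y') = X' + Y'`.

Triangle (`lawEntropy_sub_add_le`): `h(τ) + h(μ) ≤ 2 h(ν)`, without log-concavity. With doubling
this gives `h(τ) ≤ h(μ) + 2 n log 2`; exponentiating yields the factor 16 and the remaining bounds.

All entropies are finite because a bounded density together with a first moment suffices.
`LogConcaveFun.exists_le_exp` supplies both for `μ`, and both pass to sums and differences. -/

theorem LogConcaveFun.convex_superlevel (hf : LogConcaveFun f) {c : ℝ} (hc : 0 < c) :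
    Convex ℝ {x | c ≤ f x} := by
  intro x hx y hy a b ha hb hab
  obtain rfl : b = 1 - a := by linarith
  refine le_trans ?_ (hf.2 x y a ha (by linarith))
  calc c = c ^ a * c ^ (1 - a) := by rw [← Real.rpow_add hc]; simp
    _ ≤ f x ^ a * f y ^ (1 - a) :=
      mul_le_mul (Real.rpow_le_rpow hc.le hx ha) (Real.rpow_le_rpow hc.le hy hb)
        (by positivity) (Real.rpow_nonneg (hf.1 x) _)

theorem LogConcaveFun.sqrt_mul_sqrt_le (hf : LogConcaveFun f) (x y : EuclideanSpace ℝ (Fin n)) :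
    √(f x) * √(f y) ≤ f ((1 / 2 : ℝ) • (x + y)) := by
  have h := hf.2 x y (1 / 2) (by norm_num) (by norm_num)
  rw [show (1 - 1 / 2 : ℝ) = 1 / 2 by norm_num, ← smul_add] at h
  simpa only [Real.sqrt_eq_rpow] using h

/-- A log-concave function which does not vanish almost everywhere is bounded below by a positive
constant on some ball. -/
theorem LogConcaveFun.exists_ball_le (hf : LogConcaveFun f) (h0 : ¬ f =ᵐ[volume] 0) :
    ∃ x₀ r c, 0 < r ∧ 0 < c ∧ ∀ y ∈ Metric.ball x₀ r, c ≤ f y := by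
  obtain ⟨k, hk⟩ : ∃ k : ℕ, volume {x | 1 / ((k : ℝ) + 1) ≤ f x} ≠ 0 := by
    by_contra! h
    refine h0 ?_
    have h1 : ∀ᵐ x, ∀ k : ℕ, ¬ (1 / ((k : ℝ) + 1) ≤ f x) := by
      rw [ae_all_iff]
      intro k
      simpa [ae_iff] using h k
    filter_upwards [h1] with x hx
    by_contra hne
    have hpos : 0 < f x := lt_of_le_of_ne (hf.1 x) (Ne.symm hne)
    obtain ⟨k, hk⟩ := exists_nat_one_div_lt hpos
    exact hx k hk.le
  have hc : (0 : ℝ) < 1 / ((k : ℝ) + 1) := by positivity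
  have hconv := hf.convex_superlevel hc
  -- The frontier of a convex set is null, so a convex set of positive measure cannot have empty
  -- interior.
  have hint : (interior {x | 1 / ((k : ℝ) + 1) ≤ f x}).Nonempty := by
    by_contra hne
    rw [Set.not_nonempty_iff_eq_empty] at hne
    refine hk (measure_mono_null ?_ (hconv.addHaar_frontier volume))
    rw [frontier, hne, Set.sdiff_empty]
    exact subset_closure
  obtain ⟨x₀, hx₀⟩ := hint
  obtain ⟨r, hr, hball⟩ := Metric.isOpen_iff.1 isOpen_interior x₀ hx₀
  exact ⟨x₀, r, _, hr, hc, fun y hy => by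
    have h := interior_subset (hball hy)
    exact h⟩

/-- Mass that log-concavity forces halfway between a point and a ball where `f` is at least `c`. -/
theorem LogConcaveFun.sqrt_mul_volume_le (hf : LogConcaveFun f)
    {μ : Measure (EuclideanSpace ℝ (Fin n))} [IsProbabilityMeasure μ]
    (hμ : μ = volume.withDensity (fun x => ENNReal.ofReal (f x)))
    {x₀ : EuclideanSpace ℝ (Fin n)} {r c : ℝ} (hc : 0 < c)
    (hball : ∀ y ∈ Metric.ball x₀ r, c ≤ f y) (x : EuclideanSpace ℝ (Fin n)) :
    √(f x) * √c * volume.real (Metric.ball (0 : EuclideanSpace ℝ (Fin n)) (r / 2)) ≤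
      μ.real (Metric.ball ((1 / 2 : ℝ) • (x + x₀)) (r / 2)) := by
  set B := Metric.ball ((1 / 2 : ℝ) • (x + x₀)) (r / 2) with hB
  -- Each `z` in `B` is the midpoint of `x` and its reflection `2z - x`, which lies in the ball
  -- where `f ≥ c`.
  have hlow : ∀ z ∈ B, √(f x) * √c ≤ f z := by
    intro z hz
    have hy : (2 : ℝ) • z - x ∈ Metric.ball x₀ r := by
      rw [mem_ball_iff_norm] at hz ⊢
      have : (2 : ℝ) • z - x - x₀ = (2 : ℝ) • (z - (1 / 2 : ℝ) • (x + x₀)) := by module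
      rw [this, norm_smul, Real.norm_ofNat]
      linarith
    have h := hf.sqrt_mul_sqrt_le x ((2 : ℝ) • z - x)
    rw [show (1 / 2 : ℝ) • (x + ((2 : ℝ) • z - x)) = z by module] at h
    exact le_trans (mul_le_mul_of_nonneg_left (Real.sqrt_le_sqrt (hball _ hy))
      (Real.sqrt_nonneg _)) h
  have hle : ENNReal.ofReal (√(f x) * √c) * volume B ≤ μ B := by
    rw [hμ, withDensity_apply _ Metric.isOpen_ball.measurableSet, ← setLIntegral_const]
    exact setLIntegral_mono' Metric.isOpen_ball.measurableSet
      fun z hz => ENNReal.ofReal_le_ofReal (hlow z hz)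
  have hvol : volume B = volume (Metric.ball (0 : EuclideanSpace ℝ (Fin n)) (r / 2)) := by
    rw [hB, Measure.addHaar_ball_center]
  have h := ENNReal.toReal_mono (measure_ne_top μ B) hle
  rwa [ENNReal.toReal_mul, ENNReal.toReal_ofReal (by positivity), hvol] at h

/-- A log-concave probability density decays exponentially. -/
theorem LogConcaveFun.exists_le_exp (hf : LogConcaveFun f)
    {μ : Measure (EuclideanSpace ℝ (Fin n))} [IsProbabilityMeasure μ]
    (hμ : μ = volume.withDensity (fun x => ENNReal.ofReal (f x))) :
    ∃ K a : ℝ, 0 < K ∧ 0 < a ∧ ∀ x, f x ≤ K * Real.exp (-(a * ‖x‖)) := by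
  have h0 : ¬ f =ᵐ[volume] 0 := by
    intro h
    have : μ Set.univ = 0 := by
      rw [hμ, withDensity_apply _ MeasurableSet.univ, setLIntegral_univ,
        lintegral_congr_ae (g := 0) (by filter_upwards [h] with x hx; simp [hx])]
      simp
    simp at this
  obtain ⟨x₀, r, c, hr, hc, hball⟩ := hf.exists_ball_le h0
  set V := volume.real (Metric.ball (0 : EuclideanSpace ℝ (Fin n)) (r / 2)) with hV
  have hVpos : 0 < V := by
    rw [hV, measureReal_def]
    exact ENNReal.toReal_pos (Metric.measure_ball_pos _ _ (by positivity)).ne'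
      measure_ball_lt_top.ne
  have hmid := hf.sqrt_mul_volume_le hμ hc hball
  have hsc : 0 < √c := Real.sqrt_pos.2 hc
  -- The midpoint ball has mass at most 1, which bounds `√(f x)` uniformly.
  obtain ⟨M, hM0, hM⟩ : ∃ M, 0 < M ∧ ∀ x, f x ≤ M := by
    refine ⟨(1 / (√c * V)) ^ 2, by positivity, fun x => ?_⟩
    have h1 : √(f x) ≤ 1 / (√c * V) := by
      rw [le_div_iff₀ (by positivity), ← mul_assoc]
      exact (hmid x).trans measureReal_le_one
    calc f x = √(f x) ^ 2 := (Real.sq_sqrt (hf.1 x)).symm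
      _ ≤ _ := by gcongr
  -- As `x` goes to infinity so does the midpoint ball, and by tightness its mass tends to 0. The
  -- threshold carries `exp (-1/2)` because the estimate controls `√(f x)` and is then squared.
  obtain ⟨R₀, hR₀, hsmall⟩ : ∃ R₀, 0 < R₀ ∧ ∀ x, R₀ ≤ ‖x - x₀‖ → f x ≤ c * Real.exp (-1) := by
    have ht := tendsto_measure_norm_gt_of_isTightMeasureSet
      (isTightMeasureSet_singleton (μ := μ))
    have hε : (0 : ℝ≥0∞) < ENNReal.ofReal (c * Real.exp (-1 / 2) * V) := by
      rw [ENNReal.ofReal_pos]; positivity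
    obtain ⟨R, hR⟩ := ((tendsto_order.1 ht).2 _ hε).exists
    have hR : μ {x | R < ‖x‖} < ENNReal.ofReal (c * Real.exp (-1 / 2) * V) := by
      simpa using hR
    refine ⟨2 * (|R| + ‖x₀‖ + r), by positivity, fun x hx => ?_⟩
    have hsub : Metric.ball ((1 / 2 : ℝ) • (x + x₀)) (r / 2) ⊆ {x | R < ‖x‖} := by
      intro z hz
      rw [mem_ball_iff_norm] at hz
      have h1 : ‖x - x₀‖ ≤ 2 * ‖z - (1 / 2 : ℝ) • (x + x₀)‖ + 2 * ‖z‖ + 2 * ‖x₀‖ := by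
        have : x - x₀ = -(2 : ℝ) • (z - (1 / 2 : ℝ) • (x + x₀)) + (2 : ℝ) • z
          + -(2 : ℝ) • x₀ := by module
        rw [this]
        refine (norm_add₃_le).trans (le_of_eq ?_)
        simp [norm_smul]
      have := le_abs_self R
      simp only [Set.mem_ofPred_eq]
      linarith
    have h2 : √(f x) * √c * V ≤ c * Real.exp (-1 / 2) * V :=
      (hmid x).trans ((measureReal_mono hsub).trans
        (ENNReal.toReal_le_of_le_ofReal (by positivity) hR.le))
    have h3 : √(f x) ≤ √c * Real.exp (-1 / 2) := by
      have h4 : √(f x) * √c ≤ c * Real.exp (-1 / 2) := le_of_mul_le_mul_right h2 hVpos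
      have h5 : c = √c * √c := (Real.mul_self_sqrt hc.le).symm
      refine le_of_mul_le_mul_right (h4.trans (le_of_eq ?_)) hsc
      nth_rewrite 1 [h5]
      ring
    calc f x = √(f x) ^ 2 := (Real.sq_sqrt (hf.1 x)).symm
      _ ≤ (√c * Real.exp (-1 / 2)) ^ 2 := by gcongr
      _ = c * Real.exp (-1) := by
        rw [mul_pow, Real.sq_sqrt hc.le, ← Real.exp_nat_mul]; norm_num
  -- Beyond `R₀`, take the point of the segment from `x₀` to `x` at distance exactly `R₀` from `x₀`.
  -- There `f ≤ c / e`, while `f x₀ ≥ c`, so log-concavity gives `f(x)^α ≤ c^α / e`; the power `1 /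
  -- α = ‖x - x₀‖ / R₀` is the decay. Within `R₀` the exponential is at least `1 / e`, hence the
  -- factor `exp 1` on `M`.
  have hdecay : ∀ x, f x ≤ max c (M * Real.exp 1) * Real.exp (-(‖x - x₀‖ / R₀)) := by
    intro x
    rcases le_or_gt R₀ ‖x - x₀‖ with hx | hx
    · have hpos : 0 < ‖x - x₀‖ := hR₀.trans_le hx
      set α := R₀ / ‖x - x₀‖ with hα
      have hα0 : 0 < α := by positivity
      have hα1 : α ≤ 1 := (div_le_one hpos).2 hx
      have h1 := hf.2 x x₀ α hα0.le hα1
      have h2 : f (α • x + (1 - α) • x₀) ≤ c * Real.exp (-1) := by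
        apply hsmall
        rw [show α • x + (1 - α) • x₀ - x₀ = α • (x - x₀) by module, norm_smul, Real.norm_eq_abs,
          abs_of_pos hα0, hα, div_mul_cancel₀ _ hpos.ne']
      have h3 : f x ^ α * c ^ (1 - α) ≤ c * Real.exp (-1) := by
        refine le_trans ?_ (h1.trans h2)
        gcongr
        · exact Real.rpow_nonneg (hf.1 x) _
        exact hball x₀ (Metric.mem_ball_self hr)
      have h4 : f x ^ α ≤ c ^ α * Real.exp (-1) := by
        have h5 : c = c ^ α * c ^ (1 - α) := by rw [← Real.rpow_add hc]; simp
        have h6 : 0 < c ^ (1 - α) := Real.rpow_pos_of_pos hc _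
        refine le_of_mul_le_mul_right (h3.trans (le_of_eq ?_)) h6
        nth_rewrite 1 [h5]
        ring
      have h7 : f x ≤ c * Real.exp (-(‖x - x₀‖ / R₀)) := by
        rw [← Real.rpow_le_rpow_iff (hf.1 x) (by positivity) hα0,
          Real.mul_rpow hc.le (Real.exp_pos _).le, ← Real.exp_mul]
        refine h4.trans (le_of_eq ?_)
        congr 2
        rw [hα]; field_simp
      exact h7.trans (by gcongr; exact le_max_left _ _)
    · calc f x ≤ M := hM x
        _ = M * Real.exp 1 * Real.exp (-1) := by rw [mul_assoc, ← Real.exp_add]; simp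
        _ ≤ _ := by
          gcongr
          · exact le_max_right _ _
          · exact (div_le_one hR₀).2 hx.le
  refine ⟨max c (M * Real.exp 1) * Real.exp (‖x₀‖ / R₀), 1 / R₀, by positivity, by positivity,
    fun x => (hdecay x).trans ?_⟩
  rw [mul_assoc, ← Real.exp_add]
  gcongr
  have h1 : ‖x‖ - ‖x₀‖ ≤ ‖x - x₀‖ := norm_sub_norm_le x x₀
  have h2 : (‖x‖ - ‖x₀‖) / R₀ ≤ ‖x - x₀‖ / R₀ := by gcongr
  rw [sub_div] at h2
  have h3 : 1 / R₀ * ‖x‖ = ‖x‖ / R₀ := by ring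
  linarith

theorem integrable_norm_mul_exp_neg {a : ℝ} (ha : 0 < a) :
    Integrable (fun x : EuclideanSpace ℝ (Fin n) => ‖x‖ * Real.exp (-(a * ‖x‖))) := by
  have hint : Integrable (fun x : EuclideanSpace ℝ (Fin n) => (1 + ‖x‖) ^ (-((n : ℝ) + 1))) :=
    integrable_one_add_norm (by simp)
  refine (hint.const_mul (((n + 2).factorial : ℝ) * Real.exp a / a ^ (n + 2))).mono'
    (by fun_prop) (ae_of_all _ fun x => ?_)
  have hs : 0 ≤ ‖x‖ := norm_nonneg x
  set s := ‖x‖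
  rw [Real.norm_of_nonneg (by positivity)]
  -- Power `n + 2`: `n + 1` for the integrable majorant `(1 + ‖x‖)^(-(n+1))`, one more for the
  -- factor `‖x‖`.
  have h1 := Real.pow_div_factorial_le_exp (a * (1 + s)) (by positivity) (n + 2)
  have h2 : (1 + s) ^ (-((n : ℝ) + 1)) = ((1 + s) ^ (n + 1))⁻¹ := by
    rw [Real.rpow_neg (by positivity)]; norm_cast
  rw [h2, ← div_eq_mul_inv, div_div, le_div_iff₀ (by positivity), Real.exp_neg, ← div_eq_mul_inv,
    div_mul_eq_mul_div, div_le_iff₀ (by positivity)]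
  rw [div_le_iff₀ (by positivity), mul_add, mul_one, Real.exp_add] at h1
  calc s * (a ^ (n + 2) * (1 + s) ^ (n + 1))
      ≤ (1 + s) * (a ^ (n + 2) * (1 + s) ^ (n + 1)) := by gcongr; linarith
    _ = (a + a * s) ^ (n + 2) := by
      rw [show a + a * s = a * (1 + s) by ring, mul_pow]; ring
    _ ≤ _ := h1
    _ = _ := by ring

/-- A log-concave law is dominated by a multiple of Lebesgue measure and has a first moment. -/
theorem LogConcaveFun.exists_le_smul_volume_and_integrable_norm (hf : LogConcaveFun f)
    {μ : Measure (EuclideanSpace ℝ (Fin n))} [IsProbabilityMeasure μ]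
    (hfm : Measurable f) (hμ : μ = volume.withDensity (fun x => ENNReal.ofReal (f x))) :
    (∃ M : ℝ, μ ≤ ENNReal.ofReal M • volume) ∧ Integrable (fun x => ‖x‖) μ := by
  obtain ⟨K, a, hK, ha, h⟩ := hf.exists_le_exp hμ
  constructor
  · refine ⟨K, ?_⟩
    rw [hμ, ← withDensity_const]
    refine withDensity_mono (ae_of_all _ fun x => ENNReal.ofReal_le_ofReal ((h x).trans ?_))
    refine mul_le_of_le_one_right hK.le (Real.exp_le_one_iff.2 ?_)
    have : 0 ≤ a * ‖x‖ := by positivity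
    linarith
  · rw [hμ, integrable_withDensity_iff (by fun_prop) (ae_of_all _ fun x => by simp)]
    refine ((integrable_norm_mul_exp_neg ha).const_mul K).mono' (by fun_prop)
      (ae_of_all _ fun x => ?_)
    rw [ENNReal.toReal_ofReal (hf.1 x), Real.norm_of_nonneg (mul_nonneg (norm_nonneg x) (hf.1 x))]
    calc ‖x‖ * f x ≤ ‖x‖ * (K * Real.exp (-(a * ‖x‖))) := by gcongr; exact h x
      _ = _ := by ring

end LogConcave

/-! ### Bounded density and first moment imply finite entropy -/

section FiniteEntropy

variable {n : ℕ}

/-- The bound `M` controls `t log t` from above. From below, `log u ≤ u - 1` at `u = (1 + s)^(-k) /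
t` compares `t` with a polynomially decaying weight, and `log (1 + s) ≤ s` leaves only a first
moment. With `s = ‖x‖` and `k = n + 1` every term is integrable. -/
theorem abs_mul_log_le {t M s : ℝ} (ht : 0 ≤ t) (htM : t ≤ M) (hs : 0 ≤ s) (k : ℝ) (hk : 0 ≤ k) :
    |t * Real.log t| ≤ |Real.log M| * t + k * (t * s) + (1 + s) ^ (-k) := by
  have h1s : (0 : ℝ) < 1 + s := by linarith
  have hp : 0 < (1 + s) ^ (-k) := Real.rpow_pos_of_pos h1s _
  rcases ht.eq_or_lt with rfl | ht
  · simp [hp.le]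
  have hA : 0 ≤ |Real.log M| * t := by positivity
  have hB : 0 ≤ k * (t * s) := by positivity
  rw [abs_le]
  constructor
  · have h1 : Real.log ((1 + s) ^ (-k) / t) ≤ (1 + s) ^ (-k) / t - 1 :=
      Real.log_le_sub_one_of_pos (by positivity)
    rw [Real.log_div hp.ne' ht.ne', Real.log_rpow h1s] at h1
    have h2 : Real.log (1 + s) ≤ s := by
      have := Real.log_le_sub_one_of_pos h1s; linarith
    have h3 := mul_le_mul_of_nonneg_left h1 ht.le
    have h4 : t * ((1 + s) ^ (-k) / t - 1) = (1 + s) ^ (-k) - t := by field_simp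
    have h5 : k * (t * Real.log (1 + s)) ≤ k * (t * s) := by gcongr
    nlinarith
  · have h1 : Real.log t ≤ |Real.log M| := (Real.log_le_log ht htM).trans (le_abs_self _)
    have h2 := mul_le_mul_of_nonneg_left h1 ht.le
    nlinarith

theorem integrable_rnDeriv_mul_log_rnDeriv {ν : Measure (EuclideanSpace ℝ (Fin n))}
    [IsFiniteMeasure ν] {M : ℝ} (hM : ν ≤ ENNReal.ofReal M • volume)
    (hν : Integrable (fun x => ‖x‖) ν) :
    Integrable (fun x => (ν.rnDeriv volume x).toReal * Real.log (ν.rnDeriv volume x).toReal)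
      volume := by
  have hac : ν ≪ volume := Measure.absolutelyContinuous_of_le_smul hM
  have hle : ∀ᵐ x, ν.rnDeriv volume x ≤ ENNReal.ofReal M := by
    refine ae_le_of_forall_setLIntegral_le_of_sigmaFinite (Measure.measurable_rnDeriv _ _)
      fun s hs _ => ?_
    rw [setLIntegral_const]
    exact (Measure.setLIntegral_rnDeriv_le s).trans (by simpa using hM s)
  have h1 : Integrable (fun x => (ν.rnDeriv volume x).toReal) volume :=
    Measure.integrable_toReal_rnDeriv
  have h2 : Integrable (fun x => (ν.rnDeriv volume x).toReal * ‖x‖) volume :=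
    (integrable_toReal_rnDeriv_mul_iff hac).2 hν
  have h3 : Integrable (fun x : EuclideanSpace ℝ (Fin n) => (1 + ‖x‖) ^ (-((n : ℝ) + 1))) :=
    integrable_one_add_norm (by simp)
  refine (((h1.const_mul |Real.log (max M 0)|).add (h2.const_mul ((n : ℝ) + 1))).add h3).mono'
    (by
      have := Measure.measurable_rnDeriv ν volume
      fun_prop) ?_
  filter_upwards [hle] with x hx
  have hx' : (ν.rnDeriv volume x).toReal ≤ max M 0 := by
    have := ENNReal.toReal_mono ENNReal.ofReal_ne_top hx
    rwa [ENNReal.toReal_ofReal'] at this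
  exact abs_mul_log_le ENNReal.toReal_nonneg hx' (norm_nonneg x) _ (by positivity)

end FiniteEntropy

/-! ### The two entropy inequalities -/

section LawEntropy

variable {n : ℕ}

/-- Logarithm of the Lebesgue density of a measure. -/
noncomputable def logDensity (ν : Measure (EuclideanSpace ℝ (Fin n)))
    (x : EuclideanSpace ℝ (Fin n)) : ℝ :=
  Real.log (ν.rnDeriv volume x).toReal

/-- Differential entropy of a law, `-∫ log ρ dν` for the Lebesgue density `ρ` of `ν`. -/
noncomputable def lawEntropy (ν : Measure (EuclideanSpace ℝ (Fin n))) : ℝ :=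
  -∫ x, logDensity ν x ∂ν

theorem toReal_rnDeriv_pos_ae {ν : Measure (EuclideanSpace ℝ (Fin n))} [IsFiniteMeasure ν]
    (hν : ν ≪ volume) :
    ∀ᵐ x ∂ν, 0 < (ν.rnDeriv volume x).toReal ∧
      ENNReal.ofReal (ν.rnDeriv volume x).toReal = ν.rnDeriv volume x := by
  filter_upwards [Measure.rnDeriv_pos hν, hν.ae_le (Measure.rnDeriv_lt_top ν volume)] with x h1 h2
  exact ⟨ENNReal.toReal_pos h1.ne' h2.ne, ENNReal.ofReal_toReal h2.ne⟩

/-- Jensen's inequality for the exponential, in the form `𝔼 e^U ≤ 1 → 𝔼 U ≤ 0`. -/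
theorem integral_nonpos_of_lintegral_exp_le_one {T : Type*} [MeasurableSpace T] {Q : Measure T}
    [IsProbabilityMeasure Q] {U : T → ℝ} (hU : Integrable U Q)
    (h : ∫⁻ t, ENNReal.ofReal (Real.exp (U t)) ∂Q ≤ 1) : ∫ t, U t ∂Q ≤ 0 := by
  have hm : AEStronglyMeasurable (fun t => Real.exp (U t)) Q :=
    Real.continuous_exp.comp_aestronglyMeasurable hU.1
  have hint : Integrable (fun t => Real.exp (U t)) Q :=
    (lintegral_ofReal_ne_top_iff_integrable hm (ae_of_all _ fun t => (Real.exp_pos _).le)).1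
      (h.trans_lt ENNReal.one_lt_top).ne
  have h1 : ∫ t, Real.exp (U t) ∂Q ≤ 1 := by
    rw [integral_eq_lintegral_of_nonneg_ae (ae_of_all _ fun t => (Real.exp_pos _).le) hm]
    exact ENNReal.toReal_le_of_le_ofReal zero_le_one (by simpa using h)
  have h2 : ∫ t, (U t + 1) ∂Q ≤ ∫ t, Real.exp (U t) ∂Q :=
    integral_mono (hU.add (integrable_const 1)) hint fun t => Real.add_one_le_exp _
  rw [integral_add hU (integrable_const 1)] at h2
  simp at h2
  linarith

/-- Integrating against `ν` cancels the reciprocal of its density. Only `≤` holds in general, since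
the mass of `F` where the density vanishes is lost. This removes the denominators of `e^U` in both
entropy inequalities. -/
theorem lintegral_mul_inv_rnDeriv_le {ν : Measure (EuclideanSpace ℝ (Fin n))} [IsFiniteMeasure ν]
    (hν : ν ≪ volume) {F : EuclideanSpace ℝ (Fin n) → ℝ≥0∞} (hF : Measurable F) :
    ∫⁻ x, F x * (ν.rnDeriv volume x)⁻¹ ∂ν ≤ ∫⁻ x, F x := by
  have hm := Measure.measurable_rnDeriv ν volume
  rw [← lintegral_rnDeriv_mul hν (f := fun x => F x * (ν.rnDeriv volume x)⁻¹) (by fun_prop)]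
  refine lintegral_mono fun x => ?_
  calc ν.rnDeriv volume x * (F x * (ν.rnDeriv volume x)⁻¹)
      = F x * (ν.rnDeriv volume x * (ν.rnDeriv volume x)⁻¹) := by ring
    _ ≤ F x * 1 := by gcongr; exact ENNReal.mul_inv_le_one _
    _ = F x := mul_one _

theorem lintegral_comp_half (F : EuclideanSpace ℝ (Fin n) → ℝ≥0∞) (hF : Measurable F) :
    ∫⁻ x, F ((1 / 2 : ℝ) • x) = 2 ^ n * ∫⁻ x, F x := by
  rw [← lintegral_map (μ := volume) hF (by fun_prop : Measurable fun x => (1 / 2 : ℝ) • x),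
    Measure.map_addHaar_smul volume (by norm_num), lintegral_smul_measure]
  simp

/-- Halving the sum of two independent vectors with the same log-concave density does not
increase entropy. -/
theorem lawEntropy_add_le {f : EuclideanSpace ℝ (Fin n) → ℝ} (hf : LogConcaveFun f)
    (hfm : Measurable f) {μ ν : Measure (EuclideanSpace ℝ (Fin n))} [IsProbabilityMeasure μ]
    (hμ : μ = volume.withDensity (fun x => ENNReal.ofReal (f x)))
    (hν : ν = (μ.prod μ).map (fun p => p.1 + p.2)) (hνac : ν ≪ volume)
    (hμi : Integrable (logDensity μ) μ) (hνi : Integrable (logDensity ν) ν) :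
    lawEntropy ν ≤ lawEntropy μ + n * Real.log 2 := by
  have hadd : MeasurePreserving
      (fun p : EuclideanSpace ℝ (Fin n) × EuclideanSpace ℝ (Fin n) => p.1 + p.2) (μ.prod μ) ν :=
    ⟨by fun_prop, hν.symm⟩
  have hfst : MeasurePreserving Prod.fst (μ.prod μ) μ := measurePreserving_fst
  have hsnd : MeasurePreserving Prod.snd (μ.prod μ) μ := measurePreserving_snd
  have : IsProbabilityMeasure ν := hν ▸ Measure.isProbabilityMeasure_map (by fun_prop)
  have hμac : μ ≪ volume := hμ ▸ withDensity_absolutelyContinuous _ _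
  have hμd : ∀ᵐ x ∂μ, 0 < f x ∧ (μ.rnDeriv volume x).toReal = f x := by
    have h1 : μ.rnDeriv volume =ᵐ[volume] fun x => ENNReal.ofReal (f x) := by
      rw [hμ]; exact Measure.rnDeriv_withDensity _ hfm.ennreal_ofReal
    filter_upwards [toReal_rnDeriv_pos_ae hμac, hμac.ae_eq h1] with x hx hx1
    rw [hx1, ENNReal.toReal_ofReal (hf.1 x)] at hx
    exact ⟨hx.1, by rw [hx1, ENNReal.toReal_ofReal (hf.1 x)]⟩
  have i1 : Integrable (fun p => 1 / 2 * logDensity μ p.1) (μ.prod μ) :=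
    (hfst.integrable_comp_of_integrable hμi).const_mul _
  have i2 : Integrable (fun p => 1 / 2 * logDensity μ p.2) (μ.prod μ) :=
    (hsnd.integrable_comp_of_integrable hμi).const_mul _
  have i3 : Integrable (fun p => logDensity ν (p.1 + p.2)) (μ.prod μ) :=
    hadd.integrable_comp_of_integrable hνi
  have i12 : Integrable (fun p => 1 / 2 * logDensity μ p.1 + 1 / 2 * logDensity μ p.2)
    (μ.prod μ) := i1.add i2
  have i12c : Integrable (fun p => 1 / 2 * logDensity μ p.1 + 1 / 2 * logDensity μ p.2
    - n * Real.log 2) (μ.prod μ) := i12.sub (integrable_const _)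
  have e1 : ∫ p, logDensity μ p.1 ∂(μ.prod μ) = ∫ x, logDensity μ x ∂μ := by
    rw [← hfst.map_eq, integral_map (by fun_prop) (by rw [hfst.map_eq]; exact hμi.1), hfst.map_eq]
  have e2 : ∫ p, logDensity μ p.2 ∂(μ.prod μ) = ∫ x, logDensity μ x ∂μ := by
    rw [← hsnd.map_eq, integral_map (by fun_prop) (by rw [hsnd.map_eq]; exact hμi.1), hsnd.map_eq]
  have e3 : ∫ p, logDensity ν (p.1 + p.2) ∂(μ.prod μ) = ∫ x, logDensity ν x ∂ν := by
    rw [← hadd.map_eq, integral_map (by fun_prop) (by rw [hadd.map_eq]; exact hνi.1), hadd.map_eq]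
  have key := integral_nonpos_of_lintegral_exp_le_one (Q := μ.prod μ)
    (U := fun p => 1 / 2 * logDensity μ p.1 + 1 / 2 * logDensity μ p.2 - n * Real.log 2
      - logDensity ν (p.1 + p.2))
    (i12c.sub i3) ?_
  · rw [integral_sub i12c i3, integral_sub i12 (integrable_const _), integral_add i1 i2,
      integral_const_mul, integral_const_mul,
      e1, e2, e3] at key
    simp only [integral_const, probReal_univ, one_smul] at key
    unfold lawEntropy
    linarith
  -- `G` is the density of `2X`; the term `n log 2` in `U` is the normalisation `2⁻ⁿ`.
  · set G : EuclideanSpace ℝ (Fin n) → ℝ≥0∞ :=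
      fun s => ENNReal.ofReal (f ((1 / 2 : ℝ) • s)) * (2 ^ n)⁻¹ with hG
    have hGm : Measurable G := by
      have := hfm.comp (by fun_prop : Measurable fun x : EuclideanSpace ℝ (Fin n) =>
        (1 / 2 : ℝ) • x)
      exact this.ennreal_ofReal.mul_const _
    have hpt : ∀ᵐ p ∂(μ.prod μ), ENNReal.ofReal (Real.exp (1 / 2 * logDensity μ p.1
        + 1 / 2 * logDensity μ p.2 - n * Real.log 2 - logDensity ν (p.1 + p.2))) ≤
        G (p.1 + p.2) * (ν.rnDeriv volume (p.1 + p.2))⁻¹ := by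
      filter_upwards [hfst.quasiMeasurePreserving.ae hμd, hsnd.quasiMeasurePreserving.ae hμd,
        hadd.quasiMeasurePreserving.ae (toReal_rnDeriv_pos_ae hνac)] with p h1 h2 h3
      have hexp : Real.exp (1 / 2 * logDensity μ p.1
          + 1 / 2 * logDensity μ p.2 - n * Real.log 2 - logDensity ν (p.1 + p.2)) =
          √(f p.1) * √(f p.2) * (2 ^ n)⁻¹ * (ν.rnDeriv volume (p.1 + p.2)).toReal⁻¹ := by
        have hs : ∀ t : ℝ, 0 < t → Real.exp (1 / 2 * Real.log t) = √t := fun t ht => by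
          rw [Real.sqrt_eq_rpow, Real.rpow_def_of_pos ht, mul_comm]
        unfold logDensity
        rw [h1.2, h2.2, sub_eq_add_neg, sub_eq_add_neg, Real.exp_add, Real.exp_add, Real.exp_add,
          hs _ h1.1, hs _ h2.1, Real.exp_neg, Real.exp_neg, Real.exp_log h3.1, Real.exp_nat_mul,
          Real.exp_log two_pos]
      rw [hexp, hG]
      have hle := hf.sqrt_mul_sqrt_le p.1 p.2
      refine (ENNReal.ofReal_le_ofReal (q := f ((1 / 2 : ℝ) • (p.1 + p.2)) * (2 ^ n)⁻¹ *
        (ν.rnDeriv volume (p.1 + p.2)).toReal⁻¹) (by gcongr)).trans (le_of_eq ?_)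
      rw [ENNReal.ofReal_mul (mul_nonneg (hf.1 _) (by positivity)), ENNReal.ofReal_mul (hf.1 _),
        ENNReal.ofReal_inv_of_pos h3.1, h3.2, ENNReal.ofReal_inv_of_pos (by positivity),
        ENNReal.ofReal_pow zero_le_two, ENNReal.ofReal_ofNat]
    refine (lintegral_mono_ae hpt).trans ?_
    have hρ := Measure.measurable_rnDeriv ν volume
    rw [hadd.lintegral_comp (f := fun s => G s * (ν.rnDeriv volume s)⁻¹) (by fun_prop)]
    refine (lintegral_mul_inv_rnDeriv_le hνac hGm).trans ?_
    have htot : ∫⁻ x, ENNReal.ofReal (f x) = 1 := by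
      have : μ Set.univ = 1 := measure_univ
      rwa [hμ, withDensity_apply _ MeasurableSet.univ, setLIntegral_univ] at this
    simp only [hG]
    rw [lintegral_mul_const _ (by fun_prop),
      lintegral_comp_half (fun x => ENNReal.ofReal (f x)) hfm.ennreal_ofReal, htot, mul_one]
    exact ENNReal.mul_inv_le_one _

/-- The Ruzsa triangle inequality `h(X - Z) + h(Y) ≤ h(X + Y) + h(Y + Z)` for independent vectors
with the same law. -/
theorem lawEntropy_sub_add_le {μ ν τ : Measure (EuclideanSpace ℝ (Fin n))} [IsProbabilityMeasure μ]
    (hν : ν = (μ.prod μ).map (fun p => p.1 + p.2)) (hτ : τ = (μ.prod μ).map (fun p => p.1 - p.2))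
    (hμac : μ ≪ volume) (hνac : ν ≪ volume) (hτac : τ ≪ volume)
    (hμi : Integrable (logDensity μ) μ) (hνi : Integrable (logDensity ν) ν)
    (hτi : Integrable (logDensity τ) τ) :
    lawEntropy τ + lawEntropy μ ≤ 2 * lawEntropy ν := by
  have hadd : MeasurePreserving
      (fun p : EuclideanSpace ℝ (Fin n) × EuclideanSpace ℝ (Fin n) => p.1 + p.2) (μ.prod μ) ν :=
    ⟨by fun_prop, hν.symm⟩
  have hsub : MeasurePreserving
      (fun p : EuclideanSpace ℝ (Fin n) × EuclideanSpace ℝ (Fin n) => p.1 - p.2) (μ.prod μ) τ :=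
    ⟨by fun_prop, hτ.symm⟩
  have : IsProbabilityMeasure ν := hν ▸ Measure.isProbabilityMeasure_map (by fun_prop)
  have : IsProbabilityMeasure τ := hτ ▸ Measure.isProbabilityMeasure_map hsub.measurable.aemeasurable
  -- The coordinates `q.1.1`, `q.1.2`, `q.2` play `X`, `Z`, `Y`. With `p`, `d`, `g` the densities of
  -- `ν`, `μ`, `τ`, the exponential used below is `e^U = p(X + Y) p(Y + Z) / (d(Y) g(X - Z))`.
  set Q := (μ.prod μ).prod μ with hQ
  have m1 : MeasurePreserving (fun q : (EuclideanSpace ℝ (Fin n) × EuclideanSpace ℝ (Fin n)) ×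
      EuclideanSpace ℝ (Fin n) => q.1.1 + q.2) Q ν :=
    hadd.comp ((measurePreserving_fst (μ := μ) (ν := μ)).prod (MeasurePreserving.id μ))
  have m2 : MeasurePreserving (fun q : (EuclideanSpace ℝ (Fin n) × EuclideanSpace ℝ (Fin n)) ×
      EuclideanSpace ℝ (Fin n) => q.1.2 + q.2) Q ν :=
    hadd.comp ((measurePreserving_snd (μ := μ) (ν := μ)).prod (MeasurePreserving.id μ))
  have m3 : MeasurePreserving (fun q : (EuclideanSpace ℝ (Fin n) × EuclideanSpace ℝ (Fin n)) ×
      EuclideanSpace ℝ (Fin n) => q.2) Q μ := measurePreserving_snd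
  have m4 : MeasurePreserving (fun q : (EuclideanSpace ℝ (Fin n) × EuclideanSpace ℝ (Fin n)) ×
      EuclideanSpace ℝ (Fin n) => q.1.1 - q.1.2) Q τ :=
    hsub.comp measurePreserving_fst
  have i1 : Integrable (fun q => logDensity ν (q.1.1 + q.2)) Q :=
    m1.integrable_comp_of_integrable hνi
  have i2 : Integrable (fun q => logDensity ν (q.1.2 + q.2)) Q :=
    m2.integrable_comp_of_integrable hνi
  have i3 : Integrable (fun q => logDensity μ (q.2)) Q :=
    m3.integrable_comp_of_integrable hμi
  have i4 : Integrable (fun q => logDensity τ (q.1.1 - q.1.2)) Q :=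
    m4.integrable_comp_of_integrable hτi
  have i12 : Integrable (fun q => logDensity ν (q.1.1 + q.2) + logDensity ν (q.1.2 + q.2)) Q :=
    i1.add i2
  have i123 : Integrable (fun q => logDensity ν (q.1.1 + q.2) + logDensity ν (q.1.2 + q.2)
    - logDensity μ q.2) Q := i12.sub i3
  have e1 : ∫ q, logDensity ν (q.1.1 + q.2) ∂Q = ∫ x, logDensity ν x ∂ν := by
    rw [← m1.map_eq, integral_map (by fun_prop) (by rw [m1.map_eq]; exact hνi.1), m1.map_eq]
  have e2 : ∫ q, logDensity ν (q.1.2 + q.2) ∂Q = ∫ x, logDensity ν x ∂ν := by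
    rw [← m2.map_eq, integral_map (by fun_prop) (by rw [m2.map_eq]; exact hνi.1), m2.map_eq]
  have e3 : ∫ q, logDensity μ q.2 ∂Q = ∫ x, logDensity μ x ∂μ := by
    rw [← m3.map_eq, integral_map (by fun_prop) (by rw [m3.map_eq]; exact hμi.1), m3.map_eq]
  have e4 : ∫ q, logDensity τ (q.1.1 - q.1.2) ∂Q = ∫ x, logDensity τ x ∂τ := by
    rw [← m4.map_eq, integral_map (by fun_prop) (by rw [m4.map_eq]; exact hτi.1), m4.map_eq]
  have key := integral_nonpos_of_lintegral_exp_le_one (Q := Q)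
    (U := fun q => logDensity ν (q.1.1 + q.2) + logDensity ν (q.1.2 + q.2) - logDensity μ q.2
      - logDensity τ (q.1.1 - q.1.2)) (i123.sub i4) ?_
  · rw [integral_sub i123 i4, integral_sub i12 i3, integral_add i1 i2,
      e1, e2, e3, e4] at key
    unfold lawEntropy
    linarith
  · have hp := Measure.measurable_rnDeriv ν volume
    have hd := Measure.measurable_rnDeriv μ volume
    have hg := Measure.measurable_rnDeriv τ volume
    set p := ν.rnDeriv volume with hp_def
    set d := μ.rnDeriv volume with hd_def
    set g := τ.rnDeriv volume with hg_def
    have hptot : ∫⁻ x, p x = 1 := by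
      rw [hp_def, Measure.lintegral_rnDeriv hνac, measure_univ]
    have hpt : ∀ᵐ q ∂Q, ENNReal.ofReal (Real.exp (logDensity ν (q.1.1 + q.2)
        + logDensity ν (q.1.2 + q.2) - logDensity μ q.2 - logDensity τ (q.1.1 - q.1.2))) =
        (p (q.1.1 + q.2) * p (q.1.2 + q.2) * (d q.2)⁻¹) * (g (q.1.1 - q.1.2))⁻¹ := by
      filter_upwards [m1.quasiMeasurePreserving.ae (toReal_rnDeriv_pos_ae hνac),
        m2.quasiMeasurePreserving.ae (toReal_rnDeriv_pos_ae hνac),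
        m3.quasiMeasurePreserving.ae (toReal_rnDeriv_pos_ae hμac),
        m4.quasiMeasurePreserving.ae (toReal_rnDeriv_pos_ae hτac)] with q h1 h2 h3 h4
      unfold logDensity
      rw [Real.exp_sub, Real.exp_sub, Real.exp_add, Real.exp_log h1.1, Real.exp_log h2.1,
        Real.exp_log h3.1, Real.exp_log h4.1, ENNReal.ofReal_div_of_pos h4.1,
        ENNReal.ofReal_div_of_pos h3.1, ENNReal.ofReal_mul h1.1.le, h1.2, h2.2, h3.2, h4.2,
        div_eq_mul_inv, div_eq_mul_inv]
    rw [lintegral_congr_ae hpt, hQ, lintegral_prod _ (by fun_prop)]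
    -- Integrating out `Y` cancels `d`; by translation invariance what remains depends only on `X -
    -- Z`, through the autocorrelation `k` of `p`. Integrating over `X - Z` then cancels `g`, and
    -- `k` has total mass 1.
    set k : EuclideanSpace ℝ (Fin n) → ℝ≥0∞ := fun w => ∫⁻ y, p (w + y) * p y with hk
    have hkm : Measurable k :=
      Measurable.lintegral_prod_right'
        (f := fun z : EuclideanSpace ℝ (Fin n) × EuclideanSpace ℝ (Fin n) => p (z.1 + z.2) * p z.2)
        (by fun_prop)
    have hinner : ∀ r : EuclideanSpace ℝ (Fin n) × EuclideanSpace ℝ (Fin n),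
        ∫⁻ y, (p (r.1 + y) * p (r.2 + y) * (d y)⁻¹) * (g (r.1 - r.2))⁻¹ ∂μ ≤
          k (r.1 - r.2) * (g (r.1 - r.2))⁻¹ := by
      intro r
      rw [lintegral_mul_const _ (by fun_prop)]
      gcongr
      refine (lintegral_mul_inv_rnDeriv_le hμac
        (F := fun y => p (r.1 + y) * p (r.2 + y)) (by fun_prop)).trans (le_of_eq ?_)
      simp only [hk]
      rw [← lintegral_add_left_eq_self (fun y => p (r.1 - r.2 + y) * p y) r.2]
      simp only [← add_assoc, sub_add_cancel]
    refine (lintegral_mono hinner).trans ?_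
    rw [hsub.lintegral_comp (f := fun w => k w * (g w)⁻¹) (by fun_prop)]
    refine (lintegral_mul_inv_rnDeriv_le hτac hkm).trans (le_of_eq ?_)
    rw [hk, lintegral_lintegral_swap (by fun_prop)]
    have h1 : ∀ y, ∫⁻ w, p (w + y) * p y = p y := fun y => by
      rw [lintegral_mul_const _ (by fun_prop), lintegral_add_right_eq_self, hptot, one_mul]
    simp only [h1, hptot]

end LawEntropy

/-! ### Density bounds and first moments under sums and differences -/

section Convolution

variable {n : ℕ} {μ : Measure (EuclideanSpace ℝ (Fin n))} [IsProbabilityMeasure μ]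

/-- With one summand fixed, the other is merely translated, so its density bound survives averaging.
-/
theorem map_add_prod_le_smul_volume {M : ℝ≥0∞} (hM : μ ≤ M • volume) :
    (μ.prod μ).map (fun p => p.1 + p.2) ≤ M • volume := by
  refine Measure.le_iff.2 fun s hs => ?_
  have hm : Measurable fun p : EuclideanSpace ℝ (Fin n) × EuclideanSpace ℝ (Fin n) =>
    p.1 + p.2 := by fun_prop
  rw [Measure.map_apply hm hs, Measure.prod_apply (hm hs)]
  calc _ ≤ ∫⁻ _, (M • (volume : Measure (EuclideanSpace ℝ (Fin n)))) s ∂μ := by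
        refine lintegral_mono fun x => (hM _).trans (le_of_eq ?_)
        simp only [Measure.smul_apply]
        congr 1
        exact measure_preimage_add volume x s
    _ = _ := by simp

theorem map_sub_prod_le_smul_volume {M : ℝ≥0∞} (hM : μ ≤ M • volume) :
    (μ.prod μ).map (fun p => p.1 - p.2) ≤ M • volume := by
  refine Measure.le_iff.2 fun s hs => ?_
  have hm : Measurable fun p : EuclideanSpace ℝ (Fin n) × EuclideanSpace ℝ (Fin n) =>
    p.1 - p.2 := by fun_prop
  rw [Measure.map_apply hm hs, Measure.prod_apply (hm hs)]
  calc _ ≤ ∫⁻ _, (M • (volume : Measure (EuclideanSpace ℝ (Fin n)))) s ∂μ := by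
        refine lintegral_mono fun x => (hM _).trans (le_of_eq ?_)
        simp only [Measure.smul_apply]
        congr 1
        exact (Measure.measurePreserving_sub_left volume x).measure_preimage hs.nullMeasurableSet
    _ = _ := by simp

theorem integrable_norm_map_prod (hμ : Integrable (fun x => ‖x‖) μ)
    {φ : EuclideanSpace ℝ (Fin n) × EuclideanSpace ℝ (Fin n) → EuclideanSpace ℝ (Fin n)}
    (hφ : Measurable φ) (hle : ∀ p, ‖φ p‖ ≤ ‖p.1‖ + ‖p.2‖) :
    Integrable (fun x => ‖x‖) ((μ.prod μ).map φ) := by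
  rw [integrable_map_measure (by fun_prop) hφ.aemeasurable]
  have h1 : Integrable (fun p : EuclideanSpace ℝ (Fin n) × EuclideanSpace ℝ (Fin n) => ‖p.1‖)
    (μ.prod μ) := hμ.comp_fst μ
  have h2 : Integrable (fun p : EuclideanSpace ℝ (Fin n) × EuclideanSpace ℝ (Fin n) => ‖p.2‖)
    (μ.prod μ) := hμ.comp_snd μ
  refine (h1.add h2).mono' (by fun_prop) (ae_of_all _ fun p => ?_)
  simpa using hle p

end Convolution

/-! ### From laws to random vectors -/

section RandomVectors

variable {Ω : Type*} [MeasurableSpace Ω] {n : ℕ} {Z : Ω → EuclideanSpace ℝ (Fin n)}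
  {P : Measure Ω}

theorem hasFiniteEntropy_of_le_smul [IsFiniteMeasure P] (hZ : AEMeasurable Z P) {M : ℝ}
    (hM : P.map Z ≤ ENNReal.ofReal M • volume) (hi : Integrable (fun x => ‖x‖) (P.map Z)) :
    HasFiniteEntropy Z P :=
  ⟨⟨hZ, inferInstance, Measure.absolutelyContinuous_of_le_smul hM⟩,
    integrable_rnDeriv_mul_log_rnDeriv hM hi⟩

theorem entropy_eq_lawEntropy [IsFiniteMeasure P] (h : P.map Z ≪ volume) :
    entropy Z P = lawEntropy (P.map Z) := by
  unfold entropy lawEntropy pdf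
  rw [← integral_toReal_rnDeriv_mul h]
  rfl

theorem integrable_logDensity {ν : Measure (EuclideanSpace ℝ (Fin n))} [IsFiniteMeasure ν] {M : ℝ}
    (hM : ν ≤ ENNReal.ofReal M • volume) (hi : Integrable (fun x => ‖x‖) ν) :
    Integrable (logDensity ν) ν :=
  (integrable_toReal_rnDeriv_mul_iff (Measure.absolutelyContinuous_of_le_smul hM)).1
    (integrable_rnDeriv_mul_log_rnDeriv hM hi)

end RandomVectors

end RuzsaEntropy

theorem corollary8p1 {Ω : Type*} [MeasurableSpace Ω] (P : Measure Ω) [IsProbabilityMeasure P]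
    {n : ℕ} (hn : 0 < n) (X : Ω → EuclideanSpace ℝ (Fin n))
    (hX : RuzsaEntropy.LogConcaveVector X P) :
    RuzsaEntropy.HasFiniteEntropy X P ∧
    (∀ X' : Ω → EuclideanSpace ℝ (Fin n), IdentDistrib X X' P P → IndepFun X X' P →
      RuzsaEntropy.HasFiniteEntropy (fun ω => X ω - X' ω) P ∧
      RuzsaEntropy.entropyPower (fun ω => X ω - X' ω) P ≤ 16 * RuzsaEntropy.entropyPower X P) ∧
    RuzsaEntropy.differenceConstant X P ≤ 8 ∧
    RuzsaEntropy.HasFiniteRuzsaDiv X X P ∧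
    RuzsaEntropy.differenceConstant X P =
      1 / 2 * Real.exp (2 / n * RuzsaEntropy.ruzsaDiv X X P) ∧
    RuzsaEntropy.ruzsaDiv X X P ≤ 2 * n * Real.log 2 ∧
    RuzsaEntropy.HasFiniteRuzsaDiv X (fun ω => -X ω) P ∧
    RuzsaEntropy.ruzsaDiv X (fun ω => -X ω) P ≤ n * Real.log 2 := by
  open RuzsaEntropy in
  obtain ⟨hXm, f, hfm, hf, hlaw⟩ := hX
  set μ := P.map X with hμ
  have : IsProbabilityMeasure μ := Measure.isProbabilityMeasure_map hXm
  set ν := (μ.prod μ).map (fun p => p.1 + p.2) with hν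
  set τ := (μ.prod μ).map (fun p => p.1 - p.2) with hτ
  have hsubm : Measurable fun p : EuclideanSpace ℝ (Fin n) × EuclideanSpace ℝ (Fin n) =>
    p.1 - p.2 := by fun_prop
  obtain ⟨⟨M, hM⟩, hi⟩ := hf.exists_le_smul_volume_and_integrable_norm hfm hlaw
  have hMν : ν ≤ _ := map_add_prod_le_smul_volume hM
  have hMτ : τ ≤ _ := map_sub_prod_le_smul_volume hM
  have hiν : Integrable (fun x => ‖x‖) ν :=
    integrable_norm_map_prod hi (by fun_prop) fun p => norm_add_le _ _
  have hiτ : Integrable (fun x => ‖x‖) τ :=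
    integrable_norm_map_prod hi hsubm fun p => norm_sub_le _ _
  have hμac := Measure.absolutelyContinuous_of_le_smul hM
  have hνac := Measure.absolutelyContinuous_of_le_smul hMν
  have hτac := Measure.absolutelyContinuous_of_le_smul hMτ
  have hadd : lawEntropy ν ≤ lawEntropy μ + n * Real.log 2 :=
    lawEntropy_add_le hf hfm hlaw hν hνac (integrable_logDensity hM hi)
      (integrable_logDensity hMν hiν)
  have hsub : lawEntropy τ ≤ lawEntropy μ + 2 * n * Real.log 2 := by
    have := lawEntropy_sub_add_le hν hτ hμac hνac hτac (integrable_logDensity hM hi)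
      (integrable_logDensity hMν hiν) (integrable_logDensity hMτ hiτ)
    linarith
  have hneg : P.map (fun ω => -X ω) = μ.map (fun x => -x) :=
    (AEMeasurable.map_map_of_aemeasurable (by fun_prop) hXm).symm
  have : IsProbabilityMeasure (P.map fun ω => -X ω) :=
    Measure.isProbabilityMeasure_map hXm.neg
  have hind : indepCopies X X P = μ.prod μ := rfl
  have hind' : indepCopies X (fun ω => -X ω) P = (μ.prod μ).map (Prod.map id fun x => -x) := by
    unfold indepCopies
    rw [hneg, ← Measure.map_prod_map _ _ measurable_id (by fun_prop), Measure.map_id]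
  have : IsProbabilityMeasure (indepCopies X X P) := by rw [hind]; infer_instance
  have : IsProbabilityMeasure (indepCopies X (fun ω => -X ω) P) := by
    unfold indepCopies; infer_instance
  -- The difference of `X'` and a copy of `-X` has the law of a sum of independent copies, so `ν`
  -- governs (4).
  have hmap' : (indepCopies X (fun ω => -X ω) P).map (fun p => p.1 - p.2) = ν := by
    rw [hind', Measure.map_map hsubm (by fun_prop), hν]
    congr 1
    funext p
    simp
  have hfst : (indepCopies X X P).map (fun p => p.1) = μ := measurePreserving_fst.map_eq
  have hfst' : (indepCopies X (fun ω => -X ω) P).map (fun p => p.1) = μ :=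
    measurePreserving_fst.map_eq
  have hentX : entropy X P = lawEntropy μ := entropy_eq_lawEntropy hμac
  have hentτ : entropy (fun p => p.1 - p.2) (indepCopies X X P) = lawEntropy τ :=
    entropy_eq_lawEntropy hτac
  have hentν : entropy (fun p => p.1 - p.2) (indepCopies X (fun ω => -X ω) P) = lawEntropy ν := by
    rw [entropy_eq_lawEntropy (by rwa [hmap']), hmap']
  have hdiv : ruzsaDiv X X P = lawEntropy τ - lawEntropy μ := by
    unfold ruzsaDiv
    rw [hentτ, entropy_eq_lawEntropy (by rwa [hfst]), hfst]
  have hdiv' : ruzsaDiv X (fun ω => -X ω) P = lawEntropy ν - lawEntropy μ := by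
    unfold ruzsaDiv
    rw [hentν, entropy_eq_lawEntropy (by rwa [hfst']), hfst']
  have hfin : HasFiniteEntropy X P := hasFiniteEntropy_of_le_smul hXm hM hi
  have hfin_neg : HasFiniteEntropy (fun ω => -X ω) P := by
    refine hasFiniteEntropy_of_le_smul hXm.neg (M := M) ?_ ?_
    · rw [hneg]
      refine (Measure.map_mono hM (by fun_prop)).trans (le_of_eq ?_)
      rw [Measure.map_smul]
      congr 1
      exact (Measure.measurePreserving_neg volume).map_eq
    · rw [hneg, integrable_map_measure (by fun_prop) (by fun_prop)]
      simpa [Function.comp_def] using hi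
  have hn' : (0 : ℝ) < n := Nat.cast_pos.2 hn
  have hpow : Real.exp (2 * lawEntropy τ / n) ≤ 16 * Real.exp (2 * lawEntropy μ / n) := by
    -- Multiplying `2 n log 2` by `2 / n` gives `4 log 2 = log 16`.
    have h16 : (16 : ℝ) = Real.exp (4 * Real.log 2) := by
      rw [show (4 : ℝ) = (4 : ℕ) by norm_num, Real.exp_nat_mul, Real.exp_log two_pos]; norm_num
    rw [h16, ← Real.exp_add, Real.exp_le_exp, div_le_iff₀ hn', add_mul, div_mul_cancel₀ _ hn'.ne']
    linarith
  have hconst : differenceConstant X P =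
      Real.exp (2 * lawEntropy τ / n) / (2 * Real.exp (2 * lawEntropy μ / n)) := by
    unfold differenceConstant entropyPower
    rw [hentX, hentτ]
  refine ⟨hfin, ?_, ?_, ⟨hfin, hfin, ?_⟩, ?_, ?_, ⟨hfin, hfin_neg, ?_⟩, ?_⟩
  · intro X' hid hindep
    have hmap : P.map (fun ω => X ω - X' ω) = τ := by
      have h := (indepFun_iff_map_prod_eq_prod_map_map hXm hid.aemeasurable_snd).1 hindep
      rw [← hid.map_eq] at h
      rw [hτ, hμ, ← h, AEMeasurable.map_map_of_aemeasurable hsubm.aemeasurable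
        (hXm.prodMk hid.aemeasurable_snd)]
      rfl
    refine ⟨hasFiniteEntropy_of_le_smul (hXm.sub hid.aemeasurable_snd) (M := M) ?_ ?_, ?_⟩
    · rwa [hmap]
    · rwa [hmap]
    · unfold entropyPower
      rw [hentX, entropy_eq_lawEntropy (by rwa [hmap]), hmap]
      exact hpow
  · rw [hconst, div_le_iff₀ (by positivity)]
    linarith
  · exact hasFiniteEntropy_of_le_smul hsubm.aemeasurable (M := M) hMτ hiτ
  · rw [hconst, hdiv, show 2 / (n : ℝ) * (lawEntropy τ - lawEntropy μ) =
      2 * lawEntropy τ / n - 2 * lawEntropy μ / n by ring, Real.exp_sub]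
    field_simp
  · rw [hdiv]; linarith
  · exact hasFiniteEntropy_of_le_smul hsubm.aemeasurable (M := M) (by rwa [hmap']) (by rwa [hmap'])
  · rw [hdiv']; linarith
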